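/- Let $n\ge 4$. A \emph{rectifiable path} in $\mathbb{R}^n$ is a continuous map $\alpha\colon[0,1]\to\mathbb{R}^n$ of finite length, and the \emph{Fréchet distance} of two rectifiable paths is $$d_{FP}(\alpha,\beta)=\inf_{r}\,\max_{t\in[0,1]}\lVert\alpha(t)-\beta(r(t))\rVert_2,$$ where $r$ ranges over all homeomorphisms $[0,1]\to[0,1]$ with $r(0)=0$. Identify two rectifiable paths when their Fréchet distance is $0$, so that $d_{FP}$ is a metric on the set of equivalence classes, and let $\Pi_{\mathcal E}$ be the subspace of those classes $[\alpha]$ that are represented by an embedding $\alpha$ (a homeomorphism onto its image), with the restricted metric $d_{FP}$. Then for every $x\in\Pi_{\mathcal E}$ and every real $\delta>0$ the open ball $\{y\in\Pi_{\mathcal E} : d_{FP}(x,y)<\delta\}$ is path-connected (as a subspace of the metric space $(\Pi_{\mathcal E},d_{FP})$). -/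

import Mathlib

open Set Metric Topology
open scoped unitInterval

/-- A rectifiable path in `ℝⁿ` (with the Euclidean norm): a continuous map `[0,1] → ℝⁿ` whose
length, the supremum of `∑ ‖γ(tᵢ₊₁) - γ(tᵢ)‖` over finite partitions of `[0,1]`, is finite. -/
structure RectifiablePath (n : ℕ) where
  toMap : C(I, EuclideanSpace ℝ (Fin n))
  length_ne_top : eVariationOn toMap Set.univ ≠ ⊤

namespace RectifiablePath

/-- The homeomorphisms `r : [0,1] → [0,1]` with `r(0) = 0`. -/
abbrev Reparam : Type := {r : I ≃ₜ I // r 0 = 0}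

/-- The path Fréchet distance: the infimum over `r` of the maximum over `t` of
`‖α(t) - β(r(t))‖`. -/
noncomputable def frechetDist {n : ℕ} (α β : RectifiablePath n) : ℝ :=
  ⨅ r : Reparam, ⨆ t : I, ‖α.toMap t - β.toMap (r.1 t)‖

theorem frechetDist_eq {n : ℕ} (α β : RectifiablePath n) :
    frechetDist α β =
      ⨅ r : Reparam, dist α.toMap (β.toMap.comp (r.1 : C(I, I))) := by
  unfold frechetDist
  congr 1
  funext r
  rw [ContinuousMap.dist_eq_iSup]
  simp [dist_eq_norm]

theorem bddBelow_dist {n : ℕ} (α β : RectifiablePath n) :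
    BddBelow (Set.range fun r : Reparam => dist α.toMap (β.toMap.comp (r.1 : C(I, I)))) :=
  ⟨0, by rintro _ ⟨r, rfl⟩; exact dist_nonneg⟩

instance : Nonempty Reparam := ⟨⟨Homeomorph.refl I, rfl⟩⟩

theorem frechetDist_le {n : ℕ} (α β : RectifiablePath n) (r : Reparam) :
    frechetDist α β ≤ dist α.toMap (β.toMap.comp (r.1 : C(I, I))) := by
  rw [frechetDist_eq]
  exact ciInf_le (bddBelow_dist α β) r

theorem dist_comp_le {n : ℕ} (f g : C(I, EuclideanSpace ℝ (Fin n))) (h : C(I, I)) :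
    dist (f.comp h) (g.comp h) ≤ dist f g :=
  (ContinuousMap.dist_le dist_nonneg).2 fun t => ContinuousMap.dist_apply_le_dist (h t)

theorem frechetDist_self {n : ℕ} (α : RectifiablePath n) : frechetDist α α = 0 := by
  apply le_antisymm
  · have h := frechetDist_le α α ⟨Homeomorph.refl I, rfl⟩
    have e : α.toMap.comp ((Homeomorph.refl I : I ≃ₜ I) : C(I, I)) = α.toMap := by
      ext t; rfl
    simpa [e] using h
  · rw [frechetDist_eq]
    exact le_ciInf fun r => dist_nonneg

theorem frechetDist_le_swap {n : ℕ} (α β : RectifiablePath n) :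
    frechetDist α β ≤ frechetDist β α := by
  rw [frechetDist_eq β α]
  refine le_ciInf fun r => ?_
  have hr : r.1.symm 0 = 0 := by rw [Homeomorph.symm_apply_eq]; exact r.2.symm
  refine (frechetDist_le α β ⟨r.1.symm, hr⟩).trans ?_
  have h := dist_comp_le (α.toMap.comp (r.1 : C(I, I))) β.toMap (r.1.symm : C(I, I))
  have e : (α.toMap.comp (r.1 : C(I, I))).comp (r.1.symm : C(I, I)) = α.toMap := by
    ext t; simp
  rw [e] at h
  exact h.trans_eq (dist_comm _ _)

theorem frechetDist_triangle {n : ℕ} (α β γ : RectifiablePath n) :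
    frechetDist α γ ≤ frechetDist α β + frechetDist β γ := by
  rw [frechetDist_eq α β, frechetDist_eq β γ]
  refine le_ciInf_add_ciInf fun r s => ?_
  refine (frechetDist_le α γ ⟨r.1.trans s.1, by simp [r.2, s.2]⟩).trans ?_
  refine (dist_triangle _ (β.toMap.comp (r.1 : C(I, I))) _).trans ?_
  gcongr
  exact dist_comp_le β.toMap (γ.toMap.comp (s.1 : C(I, I))) (r.1 : C(I, I))

noncomputable instance (n : ℕ) : PseudoMetricSpace (RectifiablePath n) where
  dist := frechetDist
  dist_self := frechetDist_self
  dist_comm α β := le_antisymm (frechetDist_le_swap α β) (frechetDist_le_swap β α)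
  dist_triangle := frechetDist_triangle

end RectifiablePath

/-- The metric space of all rectifiable paths in `ℝⁿ`, two paths being identified when their
Fréchet distance is zero, with the metric induced by the Fréchet distance. -/
abbrev PathSpace (n : ℕ) : Type := SeparationQuotient (RectifiablePath n)

/-- The subspace of the classes that are represented by an embedding `[0,1] → ℝⁿ`, with the
restricted metric. -/
abbrev EmbeddedPathSpace (n : ℕ) : Type :=
  {p : PathSpace n // ∃ α : RectifiablePath n, IsEmbedding α.toMap ∧ SeparationQuotient.mk α = p}

/-!
Join `α` to `β` by the straight-line homotopy bent by a fixed vector `v`,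
`(1 - s) α(t) + s β(t) + s (1 - s) t v`. For `0 < s < 1` it fails to be injective at time `s`
exactly when `v` is a certain smooth function of `s`, of a point of the curve `(α(t), β(t), t)` and
of a second point of that curve. Curves of finite length are Lipschitz images of sets of reals, so
the bad vectors form a set of Hausdorff dimension at most `3`, whose complement is dense in
dimension at least `4`. An arbitrarily small good `v` therefore exists. Up to reparametrising `β`,
which does not change its class, `α` and `β` are uniformly `δ`-close, hence so are `α` and all the
intermediate curves.
-/

section BoundedVariation

variable {α E F : Type*} [LinearOrder α] [PseudoEMetricSpace E] [PseudoEMetricSpace F]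
  {f : α → E} {g : α → F} {A : Set α}

theorem eVariationOn_prodMk_le (f : α → E) (g : α → F) (A : Set α) :
    eVariationOn (fun t => (f t, g t)) A ≤ eVariationOn f A + eVariationOn g A := by
  refine iSup_le fun ⟨k, u, hu, huA⟩ => ?_
  calc ∑ i ∈ Finset.range k, edist (f (u (i + 1)), g (u (i + 1))) (f (u i), g (u i))
      ≤ ∑ i ∈ Finset.range k,
          (edist (f (u (i + 1))) (f (u i)) + edist (g (u (i + 1))) (g (u i))) :=
        Finset.sum_le_sum fun i _ => max_le le_self_add le_add_self
    _ = ∑ i ∈ Finset.range k, edist (f (u (i + 1))) (f (u i)) +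
          ∑ i ∈ Finset.range k, edist (g (u (i + 1))) (g (u i)) := Finset.sum_add_distrib
    _ ≤ eVariationOn f A + eVariationOn g A :=
        add_le_add (eVariationOn.sum_le hu huA) (eVariationOn.sum_le hu huA)

theorem boundedVariationOn_prodMk (hf : BoundedVariationOn f A) (hg : BoundedVariationOn g A) :
    BoundedVariationOn (fun t => (f t, g t)) A :=
  ne_top_of_le_ne_top (ENNReal.add_ne_top.2 ⟨hf, hg⟩) (eVariationOn_prodMk_le f g A)

theorem locallyBoundedVariationOn_prodMk (hf : LocallyBoundedVariationOn f A)
    (hg : LocallyBoundedVariationOn g A) :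
    LocallyBoundedVariationOn (fun t => (f t, g t)) A :=
  fun x y hx hy => boundedVariationOn_prodMk (hf x y hx hy) (hg x y hx hy)

end BoundedVariation

section HausdorffDimension

theorem lipschitzOnWith_of_hasConstantSpeedOnWith {E : Type*} [PseudoEMetricSpace E] {f : ℝ → E}
    {S : Set ℝ} {l : NNReal} (hf : HasConstantSpeedOnWith f S l) : LipschitzOnWith l f S := by
  intro x hx y hy
  wlog hxy : x ≤ y generalizing x y
  · rw [edist_comm, edist_comm x]
    exact this hy hx (le_of_not_ge hxy)
  calc edist (f x) (f y) ≤ eVariationOn f (S ∩ Icc x y) :=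
        eVariationOn.edist_le f ⟨hx, left_mem_Icc.2 hxy⟩ ⟨hy, right_mem_Icc.2 hxy⟩
    _ = ENNReal.ofReal (l * (y - x)) := hf hx hy
    _ = l * edist x y := by
        rw [ENNReal.ofReal_mul l.coe_nonneg, ENNReal.ofReal_coe_nnreal, edist_comm, edist_dist,
          Real.dist_eq, abs_of_nonneg (sub_nonneg.2 hxy)]

variable {α β γ X Y Z : Type*} [LinearOrder α] [LinearOrder β] [LinearOrder γ]
  [EMetricSpace X] [EMetricSpace Y] [EMetricSpace Z]

theorem exists_lipschitzOnWith_image_eq {f : α → X} {A : Set α}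
    (hf : LocallyBoundedVariationOn f A) (hA : A.Nonempty) :
    ∃ (S : Set ℝ) (φ : ℝ → X), LipschitzOnWith 1 φ S ∧ φ '' S = f '' A := by
  obtain ⟨a, ha⟩ := hA
  refine ⟨variationOnFromTo f A a '' A, naturalParameterization f A a,
    lipschitzOnWith_of_hasConstantSpeedOnWith (has_unit_speed_naturalParameterization f hf ha), ?_⟩
  rw [image_image]
  exact image_congr fun t ht => edist_eq_zero.1 (edist_naturalParameterization_eq_zero hf ha ht)

theorem dimH_image_prod_image_prod_image_le {f : α → X} {g : β → Y} {h : γ → Z} {A : Set α}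
    {B : Set β} {C : Set γ} (hf : LocallyBoundedVariationOn f A)
    (hg : LocallyBoundedVariationOn g B) (hh : LocallyBoundedVariationOn h C) :
    dimH ((f '' A) ×ˢ (g '' B) ×ˢ (h '' C)) ≤ 3 := by
  rcases ((f '' A) ×ˢ (g '' B) ×ˢ (h '' C)).eq_empty_or_nonempty with hempty | hne
  · simp [hempty]
  obtain ⟨hA, hB, hC⟩ : A.Nonempty ∧ B.Nonempty ∧ C.Nonempty := by
    simpa only [prod_nonempty_iff, image_nonempty] using hne
  obtain ⟨S, φ, hφ, hφS⟩ := exists_lipschitzOnWith_image_eq hf hA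
  obtain ⟨T, ψ, hψ, hψT⟩ := exists_lipschitzOnWith_image_eq hg hB
  obtain ⟨U, χ, hχ, hχU⟩ := exists_lipschitzOnWith_image_eq hh hC
  have hLipschitz : LipschitzOnWith 1 (Prod.map φ (Prod.map ψ χ)) (S ×ˢ T ×ˢ U) := by
    intro p hp q hq
    simpa only [ENNReal.coe_one, one_mul, Prod.edist_eq, Prod.map_fst, Prod.map_snd] using
      max_le_max (hφ hp.1 hq.1) (max_le_max (hψ hp.2.1 hq.2.1) (hχ hp.2.2 hq.2.2))
  calc dimH ((f '' A) ×ˢ (g '' B) ×ˢ (h '' C))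
      = dimH (Prod.map φ (Prod.map ψ χ) '' (S ×ˢ T ×ˢ U)) := by
        rw [prodMap_image_prod, prodMap_image_prod, hφS, hψT, hχU]
    _ ≤ dimH (S ×ˢ T ×ˢ U) := hLipschitz.dimH_image_le
    _ ≤ dimH (univ : Set (ℝ × ℝ × ℝ)) := dimH_mono (subset_univ _)
    _ = 3 := by
        rw [Real.dimH_univ_eq_finrank]
        norm_num [Module.finrank_prod]

theorem dimH_image_le_of_contDiffAt {V W : Type*} [NormedAddCommGroup V] [NormedSpace ℝ V]
    [SecondCountableTopology V] [NormedAddCommGroup W] [NormedSpace ℝ W] {f : V → W} {S : Set V}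
    (hf : ∀ x ∈ S, ContDiffAt ℝ 1 f x) : dimH (f '' S) ≤ dimH S :=
  dimH_image_le_of_locally_lipschitzOn fun x hx =>
    let ⟨K, N, hN, hK⟩ := (hf x hx).exists_lipschitzOnWith
    ⟨K, N, mem_nhdsWithin_of_mem_nhds hN, hK⟩

end HausdorffDimension

section ParabolicArc

/-- The point at time `s` of the arc of parabola from `a` to `b` that is the segment from `a` to `b`
bent in the direction `w`. It is applied both to points and, pointwise, to whole paths. -/
noncomputable def parabolicArc {M : Type*} [AddCommGroup M] [Module ℝ M] (a b w : M) (s : ℝ) : M :=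
  AffineMap.lineMap a b s + (s * (1 - s)) • w

section Module

variable {M : Type*} [AddCommGroup M] [Module ℝ M]

@[simp]
theorem parabolicArc_zero (a b w : M) : parabolicArc a b w 0 = a := by
  simp [parabolicArc]

@[simp]
theorem parabolicArc_one (a b w : M) : parabolicArc a b w 1 = b := by
  simp [parabolicArc]

/-- The only `v` for which the parabolic arcs from `p.1` to `p.2.1` bent by `p.2.2 • v` and from
`q.1` to `q.2.1` bent by `q.2.2 • v` can meet at time `s`. -/
noncomputable def collisionVector (s : ℝ) (p q : M × M × ℝ) : M :=
  (s * (1 - s) * (p.2.2 - q.2.2))⁻¹ •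
    (AffineMap.lineMap q.1 q.2.1 s - AffineMap.lineMap p.1 p.2.1 s)

theorem collisionVector_eq {s : ℝ} {p q : M × M × ℝ} {v : M} (hs₀ : s ≠ 0) (hs₁ : s ≠ 1)
    (hpq : p.2.2 ≠ q.2.2) (h : parabolicArc p.1 p.2.1 (p.2.2 • v) s =
      parabolicArc q.1 q.2.1 (q.2.2 • v) s) : collisionVector s p q = v := by
  have hne : s * (1 - s) * (p.2.2 - q.2.2) ≠ 0 :=
    mul_ne_zero (mul_ne_zero hs₀ (sub_ne_zero.2 hs₁.symm)) (sub_ne_zero.2 hpq)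
  rw [collisionVector, inv_smul_eq_iff₀ hne, sub_eq_iff_eq_add]
  simp only [parabolicArc] at h
  linear_combination (norm := module) -h

end Module

variable {E : Type*} [NormedAddCommGroup E] [NormedSpace ℝ E]

@[fun_prop]
theorem continuous_parabolicArc (a b w : E) : Continuous (parabolicArc a b w) := by
  have := AffineMap.lineMap_continuous (R := ℝ) (p := a) (q := b)
  unfold parabolicArc
  fun_prop

theorem coe_parabolicArc {X : Type*} [TopologicalSpace X] (f g h : C(X, E)) (s : ℝ) :
    ⇑(parabolicArc f g h s) = fun x => parabolicArc (f x) (g x) (h x) s := by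
  funext x
  simp [parabolicArc, AffineMap.lineMap_apply_module]

theorem dist_parabolicArc_left_le (a b w : E) {s : ℝ} (hs : s ∈ Icc (0 : ℝ) 1) :
    dist (parabolicArc a b w s) a ≤ dist a b + ‖w‖ := by
  have hs' : s * (1 - s) ∈ Icc (0 : ℝ) 1 := unitInterval.mul_mem hs (Icc.one_sub_mem hs)
  calc dist (parabolicArc a b w s) a
      ≤ dist (parabolicArc a b w s) (AffineMap.lineMap a b s) +
          dist (AffineMap.lineMap a b s) a := dist_triangle _ _ _
    _ = s * (1 - s) * ‖w‖ + s * dist a b := by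
        rw [parabolicArc, dist_self_add_left, norm_smul, dist_lineMap_left,
          Real.norm_of_nonneg hs'.1, Real.norm_of_nonneg hs.1]
    _ ≤ ‖w‖ + dist a b := add_le_add (mul_le_of_le_one_left (norm_nonneg _) hs'.2)
        (mul_le_of_le_one_left dist_nonneg hs.2)
    _ = dist a b + ‖w‖ := add_comm _ _

theorem contDiffAt_collisionVector {z : ℝ × (E × E × ℝ) × (E × E × ℝ)} (hs₀ : z.1 ≠ 0)
    (hs₁ : z.1 ≠ 1) (hτ : z.2.1.2.2 ≠ z.2.2.2.2) :
    ContDiffAt ℝ 1 (fun z : ℝ × (E × E × ℝ) × (E × E × ℝ) => collisionVector z.1 z.2.1 z.2.2)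
      z := by
  have hne : z.1 * (1 - z.1) * (z.2.1.2.2 - z.2.2.2.2) ≠ 0 :=
    mul_ne_zero (mul_ne_zero hs₀ (sub_ne_zero.2 hs₁.symm)) (sub_ne_zero.2 hτ)
  simp only [collisionVector, AffineMap.lineMap_apply_module]
  have hden : ContDiffAt ℝ 1 (fun z : ℝ × (E × E × ℝ) × (E × E × ℝ) =>
      z.1 * (1 - z.1) * (z.2.1.2.2 - z.2.2.2.2)) z := by fun_prop
  exact (hden.inv hne).smul (by fun_prop)

variable {α : Type*} [LinearOrder α] {A : Set α} {a b w : α → E} {τ : α → ℝ}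

theorem boundedVariationOn_parabolicArc (ha : BoundedVariationOn a A)
    (hb : BoundedVariationOn b A) (hw : BoundedVariationOn w A) (s : ℝ) :
    BoundedVariationOn (fun t => parabolicArc (a t) (b t) (w t) s) A := by
  let arcAt : E × E × E →L[ℝ] E :=
    (1 - s) • .fst ℝ E (E × E) + s • (.fst ℝ E E ∘L .snd ℝ E (E × E)) +
      (s * (1 - s)) • (.snd ℝ E E ∘L .snd ℝ E (E × E))
  have harc : (fun t => parabolicArc (a t) (b t) (w t) s) = arcAt ∘ fun t => (a t, b t, w t) := by
    funext t
    simp [arcAt, parabolicArc, AffineMap.lineMap_apply_module]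
  rw [harc]
  exact arcAt.lipschitz.comp_boundedVariationOn
    (boundedVariationOn_prodMk ha (boundedVariationOn_prodMk hb hw))

theorem dense_setOf_injOn_parabolicArc [FiniteDimensional ℝ E] (hE : 4 ≤ Module.finrank ℝ E)
    (ha : LocallyBoundedVariationOn a A) (hb : LocallyBoundedVariationOn b A)
    (hτ : LocallyBoundedVariationOn τ A) (hτ_inj : InjOn τ A) :
    Dense {v : E | ∀ s : ℝ, s ≠ 0 → s ≠ 1 →
      InjOn (fun t => parabolicArc (a t) (b t) (τ t • v) s) A} := by
  have := FiniteDimensional.proper_real E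
  let c : α → E × E × ℝ := fun t => (a t, b t, τ t)
  let collisions : Set (ℝ × (E × E × ℝ) × (E × E × ℝ)) :=
    (univ ×ˢ (c '' A) ×ˢ (c '' A)) ∩ {z | z.1 ≠ 0 ∧ z.1 ≠ 1 ∧ z.2.1.2.2 ≠ z.2.2.2.2}
  have hdim_collisions : dimH collisions ≤ 3 := by
    have hid : LocallyBoundedVariationOn (id : ℝ → ℝ) univ :=
      (monotone_id.monotoneOn univ).locallyBoundedVariationOn
    have hc : LocallyBoundedVariationOn c A :=
      locallyBoundedVariationOn_prodMk ha (locallyBoundedVariationOn_prodMk hb hτ)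
    exact (dimH_mono inter_subset_left).trans
      (by simpa only [image_id] using dimH_image_prod_image_prod_image_le hid hc hc)
  have hdim : dimH ((fun z => collisionVector z.1 z.2.1 z.2.2) '' collisions) <
      Module.finrank ℝ E :=
    calc _ ≤ dimH collisions :=
          dimH_image_le_of_contDiffAt fun _ ⟨_, hs₀, hs₁, hτ⟩ =>
            contDiffAt_collisionVector hs₀ hs₁ hτ
      _ ≤ 3 := hdim_collisions
      _ < Module.finrank ℝ E := by exact_mod_cast hE
  refine (dense_compl_of_dimH_lt_finrank hdim).mono fun v hv s hs₀ hs₁ t ht u hu htu => ?_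
  by_contra hne
  have hτtu : τ t ≠ τ u := hτ_inj.ne ht hu hne
  exact hv ⟨(s, c t, c u),
    ⟨⟨mem_univ s, mem_image_of_mem c ht, mem_image_of_mem c hu⟩, hs₀, hs₁, hτtu⟩,
    collisionVector_eq hs₀ hs₁ hτtu htu⟩

end ParabolicArc

section Ray

variable {E : Type*} [NormedAddCommGroup E] [NormedSpace ℝ E]

/-- The path `t ↦ t • v` from the origin to `v`. -/
def ray (v : E) : C(I, E) where
  toFun t := (t : ℝ) • v

theorem norm_ray_le (v : E) : ‖ray v‖ ≤ ‖v‖ :=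
  (ContinuousMap.norm_le _ (norm_nonneg v)).2 fun t => by
    rw [ray, ContinuousMap.coe_mk, norm_smul, Real.norm_of_nonneg t.2.1]
    exact mul_le_of_le_one_left (norm_nonneg v) t.2.2

theorem boundedVariationOn_ray (v : E) : BoundedVariationOn (ray v) univ := by
  have hcoe : BoundedVariationOn ((↑) : I → ℝ) univ :=
    (Subtype.mono_coe _).monotoneOn univ |>.boundedVariationOn fun t _ =>
      (abs_of_nonneg t.2.1).trans_le t.2.2
  exact (ContinuousLinearMap.toSpanSingleton ℝ v).lipschitz.comp_boundedVariationOn hcoe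

end Ray

namespace RectifiablePath

variable {n : ℕ} {α β : RectifiablePath n} {δ : ℝ}

theorem toMap_injective : Function.Injective (toMap : RectifiablePath n → _) := by
  rintro ⟨_, _⟩ ⟨_, _⟩ rfl
  rfl

theorem dist_le_dist_toMap (α β : RectifiablePath n) : dist α β ≤ dist α.toMap β.toMap :=
  frechetDist_le α β ⟨Homeomorph.refl I, rfl⟩

theorem continuous_of_continuous_toMap {X : Type*} [TopologicalSpace X] {f : X → RectifiablePath n}
    (hf : Continuous fun x => (f x).toMap) : Continuous f :=
  continuous_iff_continuousAt.2 fun _ => tendsto_iff_dist_tendsto_zero.2 <|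
    squeeze_zero (fun _ => dist_nonneg) (fun _ => dist_le_dist_toMap _ _)
      (tendsto_iff_dist_tendsto_zero.1 hf.continuousAt)

theorem strictMono_reparam (r : Reparam) : StrictMono r.1 :=
  r.1.continuous.strictMono_of_inj_boundedOrder (r.2.trans_le bot_le) r.1.injective

/-- The path `β ∘ r`, which represents the same class as `β`. -/
def reparam (β : RectifiablePath n) (r : Reparam) : RectifiablePath n where
  toMap := β.toMap.comp (r.1 : C(I, I))
  length_ne_top := ne_top_of_le_ne_top β.length_ne_top <|
    eVariationOn.comp_le_of_monotoneOn _ _ ((strictMono_reparam r).monotone.monotoneOn _)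
      (mapsTo_univ _ _)

theorem dist_reparam_self (β : RectifiablePath n) (r : Reparam) : dist (β.reparam r) β = 0 :=
  le_antisymm ((frechetDist_le (β.reparam r) β r).trans_eq (dist_self _)) dist_nonneg

theorem exists_dist_toMap_reparam_lt (h : dist α β < δ) :
    ∃ r : Reparam, dist α.toMap (β.reparam r).toMap < δ :=
  exists_lt_of_ciInf_lt ((frechetDist_eq α β).symm.trans_lt h)

/-- The homotopy at time `s` from `α` to `β` in which each point `α t` moves to `β t` along the
parabolic arc bent by `t • v`. -/
noncomputable def bentHomotopy (α β : RectifiablePath n) (v : EuclideanSpace ℝ (Fin n)) (s : ℝ) :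
    RectifiablePath n where
  toMap := parabolicArc α.toMap β.toMap (ray v) s
  length_ne_top := by
    rw [coe_parabolicArc]
    exact boundedVariationOn_parabolicArc α.length_ne_top β.length_ne_top
      (boundedVariationOn_ray v) s

@[simp]
theorem bentHomotopy_zero (α β : RectifiablePath n) (v : EuclideanSpace ℝ (Fin n)) :
    bentHomotopy α β v 0 = α :=
  toMap_injective (parabolicArc_zero _ _ _)

@[simp]
theorem bentHomotopy_one (α β : RectifiablePath n) (v : EuclideanSpace ℝ (Fin n)) :
    bentHomotopy α β v 1 = β :=
  toMap_injective (parabolicArc_one _ _ _)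

theorem continuous_bentHomotopy (α β : RectifiablePath n) (v : EuclideanSpace ℝ (Fin n)) :
    Continuous (bentHomotopy α β v) :=
  continuous_of_continuous_toMap (continuous_parabolicArc _ _ _)

theorem dist_bentHomotopy_left_le (α β : RectifiablePath n) (v : EuclideanSpace ℝ (Fin n)) {s : ℝ}
    (hs : s ∈ Icc (0 : ℝ) 1) :
    dist (bentHomotopy α β v s) α ≤ dist α.toMap β.toMap + ‖v‖ :=
  calc dist (bentHomotopy α β v s) α
      ≤ dist (bentHomotopy α β v s).toMap α.toMap := dist_le_dist_toMap _ _
    _ ≤ dist α.toMap β.toMap + ‖ray v‖ := dist_parabolicArc_left_le _ _ _ hs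
    _ ≤ dist α.toMap β.toMap + ‖v‖ := by grw [norm_ray_le]

theorem dense_setOf_isEmbedding_bentHomotopy (hn : 4 ≤ n) (hα : IsEmbedding α.toMap)
    (hβ : IsEmbedding β.toMap) :
    Dense {v | ∀ s, IsEmbedding (bentHomotopy α β v s).toMap} := by
  have hcoe : LocallyBoundedVariationOn ((↑) : I → ℝ) univ :=
    ((Subtype.mono_coe _).monotoneOn univ).locallyBoundedVariationOn
  have hdense := dense_setOf_injOn_parabolicArc (E := EuclideanSpace ℝ (Fin n))
    (hn.trans_eq finrank_euclideanSpace_fin.symm)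
    (BoundedVariationOn.locallyBoundedVariationOn α.length_ne_top)
    (BoundedVariationOn.locallyBoundedVariationOn β.length_ne_top)
    hcoe Subtype.val_injective.injOn
  refine hdense.mono fun v hv s => ?_
  rcases eq_or_ne s 0 with rfl | hs₀
  · rwa [bentHomotopy_zero]
  rcases eq_or_ne s 1 with rfl | hs₁
  · rwa [bentHomotopy_one]
  refine ((bentHomotopy α β v s).toMap.continuous.isClosedEmbedding ?_).isEmbedding
  rw [bentHomotopy, coe_parabolicArc, ← injOn_univ]
  exact hv s hs₀ hs₁

theorem exists_isEmbedding_bentHomotopy (hn : 4 ≤ n) (hα : IsEmbedding α.toMap)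
    (hβ : IsEmbedding β.toMap) (h : dist α.toMap β.toMap < δ) :
    ∃ v, ∀ s ∈ Icc (0 : ℝ) 1,
      IsEmbedding (bentHomotopy α β v s).toMap ∧ dist (bentHomotopy α β v s) α < δ := by
  obtain ⟨v, hv_emb, hv⟩ := (dense_setOf_isEmbedding_bentHomotopy hn hα hβ).exists_dist_lt 0
    (sub_pos.2 h)
  rw [dist_zero_left, lt_sub_iff_add_lt'] at hv
  exact ⟨v, fun s hs => ⟨hv_emb s, (dist_bentHomotopy_left_le α β v hs).trans_lt hv⟩⟩

/-- The class of an embedding, as a point of the space of embedded paths. -/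
noncomputable def toEmbedded (α : RectifiablePath n) (hα : IsEmbedding α.toMap) :
    EmbeddedPathSpace n :=
  ⟨SeparationQuotient.mk α, α, hα, rfl⟩

theorem exists_toEmbedded_eq_dist_toMap_lt (hα : IsEmbedding α.toMap) {y : EmbeddedPathSpace n}
    (hy : dist (α.toEmbedded hα) y < δ) :
    ∃ β : RectifiablePath n, ∃ hβ : IsEmbedding β.toMap,
      β.toEmbedded hβ = y ∧ dist α.toMap β.toMap < δ := by
  obtain ⟨_, β, hβ, rfl⟩ := y
  obtain ⟨r, hr⟩ := exists_dist_toMap_reparam_lt hy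
  exact ⟨β.reparam r, hβ.comp r.1.isEmbedding, Subtype.ext <|
    SeparationQuotient.mk_eq_mk.2 <| Metric.inseparable_iff.2 <| dist_reparam_self β r, hr⟩

theorem joinedIn_ball_toEmbedded (hn : 4 ≤ n) (hα : IsEmbedding α.toMap)
    (hβ : IsEmbedding β.toMap) (h : dist α.toMap β.toMap < δ) :
    JoinedIn (ball (α.toEmbedded hα) δ) (α.toEmbedded hα) (β.toEmbedded hβ) := by
  obtain ⟨v, hv⟩ := exists_isEmbedding_bentHomotopy hn hα hβ h
  let γ : Path (α.toEmbedded hα) (β.toEmbedded hβ) :=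
    { toFun s := (bentHomotopy α β v s).toEmbedded (hv s s.2).1
      continuous_toFun := (SeparationQuotient.continuous_mk.comp
        ((continuous_bentHomotopy α β v).comp continuous_subtype_val)).subtype_mk _
      source' := by simp [toEmbedded]
      target' := by simp [toEmbedded] }
  exact ⟨γ, fun s => (hv s s.2).2⟩

end RectifiablePath

open RectifiablePath in
theorem mainTheorem10 (n : ℕ) (hn : 4 ≤ n) (x : EmbeddedPathSpace n) (δ : ℝ) (hδ : 0 < δ) :
    IsPathConnected (Metric.ball x δ) := by
  obtain ⟨_, α, hα, rfl⟩ := x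
  refine ⟨α.toEmbedded hα, mem_ball_self hδ, fun {y} hy => ?_⟩
  obtain ⟨β, hβ, rfl, hαβ⟩ := exists_toEmbedded_eq_dist_toMap_lt hα (mem_ball'.1 hy)
  exact joinedIn_ball_toEmbedded hn hα hβ hαβ
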